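/- Let $r\ge 2$ be a fixed integer. A hypergraph $(V,E)$ (a set $V$ with a set $E$ of subsets of $V$) is $n$-uniform if every edge has exactly $n$ elements, and it is $r$-colorable if there is a map $c:V\to\{1,\dots,r\}$ such that the image of every edge has at least two elements. The degree of an edge is the number of other edges that intersect it. Let $D(n,r)$ be the maximum integer $D$ such that every $n$-uniform hypergraph in which all edge degrees are strictly smaller than $D$ is $r$-colorable. Then, as $n\to\infty$, $$D(n,r)=\Omega\left(\left(\frac{n}{\ln n}\right)^{\frac{r-1}{r}} r^n\right),$$ i.e. there are a constant $c>0$ and an integer $n_0$, depending only on $r$, such that $D(n,r)\ge c\,(n/\ln n)^{(r-1)/r}\,r^n$ for all $n\ge n_0$. -/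

import Mathlib

open Filter Asymptotics
open scoped Hypergraph

universe u

/-- A hypergraph is `n`-uniform if each of its edges has exactly `n` elements. -/
def Hypergraph.IsUniform {V : Type u} (H : Hypergraph V) (n : ℕ) : Prop :=
  ∀ e ∈ E(H), e.encard = n

/-- A hypergraph is `r`-colorable if there is a coloring of the vertices with `r` colors in which
no edge is monochromatic, i.e. the image of every edge has at least two elements. -/
def Hypergraph.IsColorable {V : Type u} (H : Hypergraph V) (r : ℕ) : Prop :=
  ∃ c : V → Fin r, ∀ e ∈ E(H), (c '' e).Nontrivial

/-- The degree of an edge `e`: the number of other edges that intersect `e`. -/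
noncomputable def Hypergraph.edgeDegree {V : Type u} (H : Hypergraph V) (e : Set V) : ℕ∞ :=
  {f | f ∈ E(H) ∧ f ≠ e ∧ (e ∩ f).Nonempty}.encard

/-- Every `n`-uniform hypergraph with all edge degrees strictly smaller than `d` is
`r`-colorable. -/
def SmallDegreesColorable (n r d : ℕ) : Prop :=
  ∀ (V : Type u) (H : Hypergraph V), H.IsUniform n → (∀ e ∈ E(H), H.edgeDegree e < d) →
    H.IsColorable r

/-- `D(n, r)`: the maximum `d` such that every `n`-uniform hypergraph with all edge degrees
strictly smaller than `d` is `r`-colorable. For `r ≥ 1` this maximum is attained, see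
`isGreatest_localThreshold`. -/
noncomputable def localThreshold (n r : ℕ) : ℕ :=
  sSup {d : ℕ | SmallDegreesColorable.{u} n r d}

theorem exists_forall_smallDegreesColorable_le (n r : ℕ) :
    ∃ B : ℕ, ∀ d : ℕ, SmallDegreesColorable.{u} n r d → d ≤ B := by
  let V : Type u := ULift.{u} (Fin (r * n + 1))
  let H : Hypergraph V :=
    { vertexSet := Set.univ
      edgeSet := {e | e.encard = n}
      subset_vertexSet_of_mem_edgeSet' := fun e _ => Set.subset_univ e }
  refine ⟨(Set.univ : Set (Set V)).ncard, fun d hd => ?_⟩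
  by_contra hlt
  push Not at hlt
  obtain ⟨c, hc⟩ := hd V H (fun e he => he) (fun e _ => by
    refine lt_of_le_of_lt (Set.encard_le_encard (Set.subset_univ _)) ?_
    rw [← (Set.toFinite (Set.univ : Set (Set V))).cast_ncard_eq]
    exact_mod_cast hlt)
  obtain ⟨y, hy⟩ := Fintype.exists_lt_card_fiber_of_mul_lt_card (n := n) c (by simp [V])
  obtain ⟨s, hs, hcard⟩ := Finset.exists_subset_card_eq hy.le
  obtain ⟨a, ⟨x, hx, rfl⟩, b, ⟨z, hz, rfl⟩, hab⟩ := hc (s : Set V) (by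
    show (s : Set V).encard = n
    rw [Set.encard_coe_eq_coe_finsetCard, hcard])
  have h1 := hs hx
  have h2 := hs hz
  simp only [Finset.mem_filter] at h1 h2
  exact hab (h1.2.trans h2.2.symm)

/-- The maximum in the definition of `D(n, r)` exists. -/
theorem isGreatest_localThreshold (n r : ℕ) (hr : 1 ≤ r) :
    IsGreatest {d : ℕ | SmallDegreesColorable.{u} n r d} (localThreshold.{u} n r) := by
  obtain ⟨B, hB⟩ := exists_forall_smallDegreesColorable_le.{u} n r
  have hbdd : BddAbove {d : ℕ | SmallDegreesColorable.{u} n r d} := ⟨B, fun d hd => hB d hd⟩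
  refine ⟨Nat.sSup_mem ⟨0, fun V H _ h => ⟨fun _ => ⟨0, hr⟩, fun e he => ?_⟩⟩ hbdd,
    fun d hd => le_csSup hbdd hd⟩
  exact absurd (h e he) (by simp)

/-! Write `r = m + 1` and give the vertices independent uniform weights among `n` levels. By
Pluhár's criterion it suffices that no `r` edges form an ordered chain. In an ordered chain, cut
levels `0 = y 0 < ... < y r = n - 1` confine the `i`-th edge to the levels from `y i` to `y (i +
1)`. By AM-GM the interval lengths contribute at most a constant times `r ^ (-r n)`. Each of the `r
- 1` vertices linking consecutive edges is moreover pinned to a single level, which gains a factor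
of order `1 / n` per link. A union over all cuts would lose about `n ^ (r - 1)` and cancel this
gain. So edges whose weights fit in a window of `L ≈ (n - 3 ln n) / r` levels are also forbidden,
each window costing at most `r ^ (-n) / n ^ 3`. All intervals then have length at least `L`, and
each inner cut has only `O(ln n)` positions. An event meets `O(d ^ r)` edge chains, each with total
weight `O((ln n / n) ^ (r - 1) * r ^ (-r n))` over its cuts. The local lemma therefore applies once
`d ^ r` is at most a small constant times `(n / ln n) ^ (r - 1) * r ^ (r n)`. -/

/-! ### The local lemma -/

open MeasureTheory ProbabilityTheory in
/-- The Lovász local lemma, in the form where the probabilities of the neighbours of each event sum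
to at most `1/4`. -/
theorem lovasz_local_lemma {Ω ι : Type*} [MeasurableSpace Ω] (μ : Measure Ω)
    [IsProbabilityMeasure μ] (A : ι → Set Ω) (hA : ∀ i, MeasurableSet (A i))
    (adj : ι → ι → Prop) (hrefl : ∀ i, adj i i)
    (hindep : ∀ i, ∀ s : Finset ι, (∀ j ∈ s, ¬ adj i j) →
      μ.real (A i ∩ ⋂ j ∈ s, (A j)ᶜ) = μ.real (A i) * μ.real (⋂ j ∈ s, (A j)ᶜ))
    (hsum : ∀ i, ∀ s : Finset ι, (∀ j ∈ s, adj i j) → ∑ j ∈ s, μ.real (A j) ≤ 1 / 4)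
    (s : Finset ι) : (⋂ j ∈ s, (A j)ᶜ).Nonempty := by
  classical
  have hG : ∀ s : Finset ι, MeasurableSet (⋂ j ∈ s, (A j)ᶜ) := fun s =>
    Finset.measurableSet_biInter s fun j _ => (hA j).compl
  have key : ∀ k : ℕ, ∀ s : Finset ι, s.card = k → ∀ i,
      μ.real (A i ∩ ⋂ j ∈ s, (A j)ᶜ) ≤ 2 * μ.real (A i) * μ.real (⋂ j ∈ s, (A j)ᶜ) := by
    intro k
    induction k using Nat.strong_induction_on with
    | _ k ih =>
      intro s hs i
      set s₁ := s.filter (adj i)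
      set s₂ := s.filter (fun j => ¬ adj i j)
      have h2 : μ.real (A i ∩ ⋂ j ∈ s₂, (A j)ᶜ) =
          μ.real (A i) * μ.real (⋂ j ∈ s₂, (A j)ᶜ) :=
        hindep i s₂ fun j hj => (Finset.mem_filter.1 hj).2
      have hsub : (⋂ j ∈ s, (A j)ᶜ) ⊆ ⋂ j ∈ s₂, (A j)ᶜ := by
        apply Set.biInter_mono (fun j hj => (Finset.mem_filter.1 hj).1) fun _ _ => subset_rfl
      have hle : μ.real (A i ∩ ⋂ j ∈ s, (A j)ᶜ) ≤
          μ.real (A i) * μ.real (⋂ j ∈ s₂, (A j)ᶜ) := by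
        rw [← h2]
        exact measureReal_mono (Set.inter_subset_inter_right _ hsub)
      -- Conditioned on avoiding `s₂`, the neighbours in `s₁` have total probability at most `2 * (1
      -- / 4)`, by induction. Avoiding them as well costs at most a factor 2.
      have hhalf : μ.real (⋂ j ∈ s₂, (A j)ᶜ) ≤ 2 * μ.real (⋂ j ∈ s, (A j)ᶜ) := by
        have hcov : (⋂ j ∈ s₂, (A j)ᶜ) ⊆
            (⋂ j ∈ s, (A j)ᶜ) ∪ ⋃ j ∈ s₁, (A j ∩ ⋂ l ∈ s₂, (A l)ᶜ) := by
          intro x hx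
          by_cases hx' : x ∈ ⋂ j ∈ s, (A j)ᶜ
          · exact Or.inl hx'
          · right
            simp only [Set.mem_iInter, not_forall, Set.mem_compl_iff, not_not] at hx'
            obtain ⟨j, hj, hjx⟩ := hx'
            have hj1 : j ∈ s₁ := by
              refine Finset.mem_filter.2 ⟨hj, ?_⟩
              by_contra hn
              exact (Set.mem_iInter₂.1 hx j (Finset.mem_filter.2 ⟨hj, hn⟩)) hjx
            exact Set.mem_iUnion₂.2 ⟨j, hj1, hjx, hx⟩
        have hb : ∀ j ∈ s₁, μ.real (A j ∩ ⋂ l ∈ s₂, (A l)ᶜ) ≤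
            2 * μ.real (A j) * μ.real (⋂ l ∈ s₂, (A l)ᶜ) := by
          intro j hj
          refine ih s₂.card ?_ s₂ rfl j
          rw [← hs]
          apply Finset.card_lt_card
          refine (Finset.filter_ssubset).2 ⟨j, (Finset.mem_filter.1 hj).1, ?_⟩
          simpa using (Finset.mem_filter.1 hj).2
        have h1 : μ.real (⋂ j ∈ s₂, (A j)ᶜ) ≤ μ.real (⋂ j ∈ s, (A j)ᶜ) +
            ∑ j ∈ s₁, μ.real (A j ∩ ⋂ l ∈ s₂, (A l)ᶜ) :=
          (measureReal_mono hcov).trans ((measureReal_union_le _ _).trans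
            (add_le_add_right (measureReal_biUnion_finset_le _ _) _))
        have h3 := Finset.sum_le_sum hb
        rw [← Finset.sum_mul, ← Finset.mul_sum] at h3
        have h4 := hsum i s₁ fun j hj => (Finset.mem_filter.1 hj).2
        have h5 : 0 ≤ μ.real (⋂ j ∈ s₂, (A j)ᶜ) := measureReal_nonneg
        nlinarith
      have := mul_le_mul_of_nonneg_left hhalf (measureReal_nonneg (μ := μ) (s := A i))
      linarith
  suffices h : 0 < μ.real (⋂ j ∈ s, (A j)ᶜ) by
    by_contra hne
    rw [Set.not_nonempty_iff_eq_empty.1 hne] at h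
    simp at h
  induction s using Finset.induction_on with
  | empty => simp
  | insert i s hi ih =>
    have h1 := key _ s rfl i
    have h2 := hsum i {i} (by simpa using hrefl i)
    rw [Finset.sum_singleton] at h2
    have h3 : μ.real (⋂ j ∈ s, (A j)ᶜ) ≤
        μ.real (⋂ j ∈ insert i s, (A j)ᶜ) + μ.real (A i ∩ ⋂ j ∈ s, (A j)ᶜ) := by
      refine (measureReal_mono ?_).trans (measureReal_union_le _ _)
      intro x hx
      by_cases hxi : x ∈ A i
      · exact Or.inr ⟨hxi, hx⟩
      · left
        rw [Finset.set_biInter_insert]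
        exact ⟨hxi, hx⟩
    nlinarith

open MeasureTheory ProbabilityTheory in
/-- The local lemma for box events in a product of copies of a finite set, over an arbitrary index
set and for arbitrarily many events. -/
theorem exists_avoiding_boxes {V ι α : Type*} [Fintype α] [Nonempty α]
    (S : ι → Finset V) (J : ι → V → Finset α) (hS : ∀ i, (S i).Nonempty)
    (hsum : ∀ i, ∀ s : Finset ι, (∀ j ∈ s, ¬ Disjoint (S i) (S j)) →
      ∑ j ∈ s, ∏ u ∈ S j, ((J j u).card / Fintype.card α : ℝ) ≤ 1 / 4) :
    ∃ w : V → α, ∀ i, ∃ u ∈ S i, w u ∉ J i u := by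
  classical
  let _ : MeasurableSpace α := ⊤
  have : MeasurableSingletonClass α := ⟨fun _ => trivial⟩
  let _ : TopologicalSpace α := ⊥
  have : DiscreteTopology α := ⟨rfl⟩
  let ν : Measure α := uniformOn Set.univ
  have : IsProbabilityMeasure ν := isProbabilityMeasure_uniformOn Set.finite_univ Set.univ_nonempty
  let μ : Measure (V → α) := Measure.infinitePi fun _ => ν
  let A : ι → Set (V → α) := fun i => (S i : Set V).pi fun u => (J i u : Set α)
  have hprob : ∀ i, μ.real (A i) = ∏ u ∈ S i, ((J i u).card / Fintype.card α : ℝ) := by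
    intro i
    rw [measureReal_def, Measure.infinitePi_pi _ (fun _ _ => MeasurableSet.of_discrete), ENNReal.toReal_prod]
    refine Finset.prod_congr rfl fun u _ => ?_
    change (uniformOn Set.univ ((J i u : Set α))).toReal = _
    rw [uniformOn_univ, Measure.count_apply_finset]
    simp
  have hI : iIndepFun (fun (v : V) (w : V → α) => w v) μ :=
    iIndepFun_infinitePi (P := fun _ => ν) (X := fun _ a => a) fun _ => measurable_id
  have hfin : ∀ s : Finset ι, (⋂ j ∈ s, (A j)ᶜ).Nonempty := by
    refine lovasz_local_lemma μ A ?_ (fun i j => ¬ Disjoint (S i) (S j)) ?_ ?_ ?_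
    · exact fun i => MeasurableSet.pi (S i).countable_toSet fun _ _ => MeasurableSet.of_discrete
    · intro i
      simpa using (hS i).ne_empty
    · intro i s hs
      let T : Finset V := s.biUnion S
      have hd : Disjoint (S i) T := by
        rw [Finset.disjoint_biUnion_right]
        exact fun j hj => not_not.1 (hs j hj)
      have hind := hI.indepFun_finset (S i) T hd (fun v => measurable_pi_apply v)
      have e1 : A i = (fun (w : V → α) (v : S i) => w v) ⁻¹'
          (Set.univ.pi fun v : S i => (J i v : Set α)) := by
        ext w; simp [A]
      have e2 : (⋂ j ∈ s, (A j)ᶜ) = (fun (w : V → α) (v : T) => w v) ⁻¹'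
          {x | ∀ j ∈ s, ∃ u : T, (u : V) ∈ S j ∧ x u ∉ J j u} := by
        ext w
        simp only [A, Set.mem_iInter, Set.mem_compl_iff, Set.mem_pi, Set.mem_preimage,
          Set.mem_ofPred_eq, Finset.mem_coe, not_forall]
        refine forall₂_congr fun j hj => ?_
        constructor
        · rintro ⟨u, hu, h⟩
          exact ⟨⟨u, Finset.mem_biUnion.2 ⟨j, hj, hu⟩⟩, hu, h⟩
        · rintro ⟨u, hu, h⟩
          exact ⟨u, hu, h⟩
      have := hind.measure_inter_preimage_eq_mul (Set.univ.pi fun v : S i => (J i v : Set α)) _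
        (MeasurableSet.univ_pi fun _ => MeasurableSet.of_discrete)
        (Set.toFinite {x : T → α | ∀ j ∈ s, ∃ u : T, (u : V) ∈ S j ∧ x u ∉ J j u}).measurableSet
      rw [e1, e2, measureReal_def, this, ENNReal.toReal_mul]
      rfl
    · intro i s hs
      simp_rw [hprob]
      exact hsum i s hs
  -- Each `A i` constrains finitely many coordinates, so its complement is closed in the compact
  -- product `V → α`. Compactness passes from finitely many events to all of them.
  obtain ⟨w, hw⟩ := CompactSpace.iInter_nonempty (t := fun i => (A i)ᶜ) (fun i => by
    refine IsOpen.isClosed_compl ?_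
    exact isOpen_set_pi (S i).finite_toSet fun _ _ => isOpen_discrete _) hfin
  refine ⟨w, fun i => ?_⟩
  have := Set.mem_iInter.1 hw i
  simpa [A] using this

/-! ### Ordered chains and Pluhár's criterion -/

/-- An ordered chain of edges: consecutive edges `h i`, `h (i + 1)` share the vertex `p (i + 1)`,
which is a heaviest vertex of the former and a lightest vertex of the latter. -/
def IsOrderedChain {V E α : Type*} [LE α] (S : E → Finset V) (w : V → α) {k : ℕ}
    (h : Fin k → E) (p : Fin (k + 1) → V) : Prop :=
  ∀ i : Fin k, p i.castSucc ∈ S (h i) ∧ p i.succ ∈ S (h i) ∧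
    ∀ t ∈ S (h i), w (p i.castSucc) ≤ w t ∧ w t ≤ w (p i.succ)

/-- Pluhár's criterion: if no ordered chain has `m + 1` edges, then colouring each vertex by the
length of the longest ordered chain that ends there is proper. -/
theorem exists_coloring_of_forall_not_isOrderedChain {V E α : Type*} [LinearOrder α]
    (S : E → Finset V) (w : V → α) (hS : ∀ e, (S e).Nonempty) (m : ℕ)
    (hno : ∀ (h : Fin (m + 1) → E) (p : Fin (m + 2) → V), ¬ IsOrderedChain S w h p) :
    ∃ c : V → Fin (m + 1), ∀ e, ∃ u ∈ S e, ∃ v ∈ S e, c u ≠ c v := by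
  classical
  let R : V → ℕ → Prop := fun v k => ∃ (h : Fin k → E) (p : Fin (k + 1) → V),
    p (Fin.last k) = v ∧ IsOrderedChain S w h p
  have hR0 : ∀ v, R v 0 := fun v => ⟨Fin.elim0, fun _ => v, rfl, fun i => i.elim0⟩
  refine ⟨fun v => ⟨Nat.findGreatest (R v) m, Nat.lt_succ_of_le (Nat.findGreatest_le m)⟩,
    fun e => ?_⟩
  obtain ⟨u, hu, humin⟩ := (S e).exists_min_image w (hS e)
  obtain ⟨v, hv, hvmax⟩ := (S e).exists_max_image w (hS e)
  refine ⟨u, hu, v, hv, fun heq => ?_⟩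
  have heq' : Nat.findGreatest (R u) m = Nat.findGreatest (R v) m := congrArg Fin.val heq
  set k := Nat.findGreatest (R u) m
  have hk : k ≤ m := Nat.findGreatest_le m
  obtain ⟨h, p, hp, hch⟩ : R u k := Nat.findGreatest_spec (P := R u) (Nat.zero_le m) (hR0 u)
  -- A chain ending at the lightest vertex `u` of `e` extends through `e` to the heaviest vertex
  -- `v`. Thus `v` has a larger colour than `u`, unless the extension already has `m + 1` edges.
  have hext : IsOrderedChain S w (Fin.snoc h e : Fin (k + 1) → E)
      (Fin.snoc p v : Fin (k + 2) → V) := by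
    intro i
    refine Fin.lastCases ?_ (fun i => ?_) i
    · simp only [Fin.snoc_castSucc, Fin.succ_last, Fin.snoc_last, hp]
      exact ⟨hu, hv, fun t ht => ⟨humin t ht, hvmax t ht⟩⟩
    · rw [Fin.succ_castSucc]
      simpa only [Fin.snoc_castSucc] using hch i
  have hRv : R v (k + 1) := ⟨_, _, Fin.snoc_last _ _, hext⟩
  rcases hk.lt_or_eq with hlt | hkm
  · have := Nat.le_findGreatest (P := R v) (n := m) hlt hRv
    omega
  · rw [hkm] at hRv
    obtain ⟨h', p', -, hc'⟩ := hRv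
    exact hno h' p' hc'

/-! ### Counting walks -/

/-- In a graph with all neighbourhoods of size at most `D`, there are at most `D ^ m * #X` walks
with `m` steps whose `j`-th vertex lies in `X`. -/
theorem card_walks_le {E : Type*} (nbr : E → Finset E)
    (hsymm : ∀ e f, f ∈ nbr e → e ∈ nbr f) (D : ℕ) (hD : ∀ e, (nbr e).card ≤ D) (X : Finset E)
    (m : ℕ) (j : Fin (m + 1)) (T : Finset (Fin (m + 1) → E))
    (hT : ∀ h ∈ T, h j ∈ X ∧ ∀ i : Fin m, h i.succ ∈ nbr (h i.castSucc)) :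
    T.card ≤ D ^ m * X.card := by
  classical
  induction m with
  | zero =>
    rw [pow_zero, one_mul]
    refine Finset.card_le_card_of_injOn (fun h => h j) (fun h hh => (hT h hh).1) ?_
    intro h _ h' _ heq
    funext i
    rw [(Fin.subsingleton_one).elim i j]
    exact heq
  | succ m ih =>
    -- Delete an end of the walk other than position `j`: the first vertex if `j` is last, the last
    -- vertex otherwise. Each shortened walk comes from at most `D` walks.
    refine Fin.lastCases (fun hT => ?_) (fun j hT => ?_) j hT
    · have h1 : T.card ≤ D * (T.image (Fin.tail (α := fun _ => E))).card := by
        refine Finset.card_le_mul_card_image T D fun b _ => ?_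
        refine (Finset.card_le_card_of_injOn (fun h => h 0) (t := nbr (b 0)) ?_ ?_).trans (hD (b 0))
        · intro h hh
          obtain ⟨hhT, rfl⟩ := Finset.mem_filter.1 hh
          exact hsymm _ _ ((hT h hhT).2 0)
        · intro h hh h' hh' heq
          have e1 := (Finset.mem_filter.1 hh).2
          have e2 := (Finset.mem_filter.1 hh').2
          rw [← Fin.cons_self_tail h, ← Fin.cons_self_tail h', e1, e2]
          congr 1
      have h2 := ih (Fin.last m) (T.image (Fin.tail (α := fun _ => E))) fun h hh => by
        obtain ⟨h, hhT, rfl⟩ := Finset.mem_image.1 hh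
        exact ⟨(hT h hhT).1, fun i => (hT h hhT).2 i.succ⟩
      calc T.card ≤ D * (D ^ m * X.card) := h1.trans (Nat.mul_le_mul_left D h2)
        _ = D ^ (m + 1) * X.card := by ring
    · have h1 : T.card ≤ D * (T.image (Fin.init (α := fun _ => E))).card := by
        refine Finset.card_le_mul_card_image T D fun b _ => ?_
        refine (Finset.card_le_card_of_injOn (fun h => h (Fin.last (m + 1)))
          (t := nbr (b (Fin.last m))) ?_ ?_).trans (hD _)
        · intro h hh
          obtain ⟨hhT, rfl⟩ := Finset.mem_filter.1 hh
          exact (hT h hhT).2 (Fin.last m)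
        · intro h hh h' hh' heq
          have e1 := (Finset.mem_filter.1 hh).2
          have e2 := (Finset.mem_filter.1 hh').2
          rw [← Fin.snoc_init_self h, ← Fin.snoc_init_self h', e1, e2]
          congr 1
      have h2 := ih j (T.image (Fin.init (α := fun _ => E))) fun h hh => by
        obtain ⟨h, hhT, rfl⟩ := Finset.mem_image.1 hh
        exact ⟨(hT h hhT).1, fun i => (hT h hhT).2 i.castSucc⟩
      calc T.card ≤ D * (D ^ m * X.card) := h1.trans (Nat.mul_le_mul_left D h2)
        _ = D ^ (m + 1) * X.card := by ring

/-! ### Probability of an ordered chain and number of cut sequences -/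

theorem prod_le_pow_of_sum_le {ι : Type*} [Fintype ι] [Nonempty ι] (g : ι → ℝ) (hg : ∀ i, 0 ≤ g i)
    {s : ℝ} (hs : ∑ i, g i ≤ s) : ∏ i, g i ≤ (s / Fintype.card ι) ^ Fintype.card ι := by
  have hpos : (0 : ℝ) < Fintype.card ι := by exact_mod_cast Fintype.card_pos
  have h := Real.geom_mean_le_arith_mean Finset.univ (fun _ : ι => (1 : ℝ)) g
    (fun _ _ => zero_le_one) (by simpa using hpos) fun i _ => hg i
  simp only [Real.rpow_one, Finset.sum_const, Finset.card_univ, nsmul_eq_mul, mul_one,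
    one_mul] at h
  have hP : 0 ≤ ∏ i, g i := Finset.prod_nonneg fun i _ => hg i
  calc ∏ i, g i = ((∏ i, g i) ^ (Fintype.card ι : ℝ)⁻¹) ^ Fintype.card ι :=
        (Real.rpow_inv_natCast_pow hP Fintype.card_ne_zero).symm
    _ ≤ ((∑ i, g i) / Fintype.card ι) ^ Fintype.card ι :=
        pow_le_pow_left₀ (Real.rpow_nonneg hP _) h _
    _ ≤ _ := pow_le_pow_left₀
        (div_nonneg (Finset.sum_nonneg fun i _ => hg i) hpos.le)
        (div_le_div_of_nonneg_right hs hpos.le) _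

theorem Fin.sum_succ_sub_castSucc {k : ℕ} (f : Fin (k + 1) → ℝ) :
    ∑ i : Fin k, (f i.succ - f i.castSucc) = f (Fin.last k) - f 0 := by
  have h1 := Fin.sum_univ_succ f
  have h2 := Fin.sum_univ_castSucc f
  rw [Finset.sum_sub_distrib]
  linarith

/-- The levels allowed to a vertex that lies in the edges `h i`, `i ∈ I`, of a chain whose `i`-th
edge has its levels between `y i` and `y (i + 1)`. -/
def chainLevels {m : ℕ} (n : ℕ) (y : Fin (m + 2) → ℕ) (I : Finset (Fin (m + 1))) :
    Finset (Fin n) :=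
  {b | ∀ i ∈ I, y i.castSucc ≤ b ∧ (b : ℕ) ≤ y i.succ}

theorem card_fin_filter_Icc_le (n a b : ℕ) :
    (Finset.univ.filter fun x : Fin n => a ≤ x ∧ (x : ℕ) ≤ b).card ≤ b + 1 - a := by
  rw [← Nat.card_Icc]
  exact Finset.card_le_card_of_injOn Fin.val (fun x hx => by simpa using hx)
    Fin.val_injective.injOn

/-- This bounds one vertex's factor by a product that can be regrouped over edges and links. A
vertex in two consecutive edges has a single allowed level, of probability `1 / n`, whereas the two
interval factors multiply to at least `(L / n) ^ 2`; the ratio is at most `n / L ^ 2 ≤ κ`. A vertex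
in two non-consecutive edges has no allowed level. -/
theorem card_chainLevels_div_le {m n L : ℕ} (hn : 0 < n) (hL : 0 < L) (y : Fin (m + 2) → ℕ)
    (hstep : ∀ i : Fin (m + 1), y i.castSucc + L ≤ y i.succ) {κ : ℝ} (hκ1 : κ ≤ 1)
    (hκ : (n : ℝ) ≤ κ * L ^ 2) (I : Finset (Fin (m + 1))) :
    ((chainLevels n y I).card / n : ℝ) ≤
      (∏ i ∈ I, (((y i.succ : ℝ) - y i.castSucc + 1) / n)) *
        ∏ _i ∈ Finset.univ.filter (fun i : Fin m => i.castSucc ∈ I ∧ i.succ ∈ I), κ := by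
  classical
  have hn' : (0 : ℝ) < n := by exact_mod_cast hn
  have hL' : (0 : ℝ) < L := by exact_mod_cast hL
  have hκ0 : 0 < κ := by
    by_contra h
    nlinarith [sq_nonneg (L : ℝ)]
  have hg : ∀ i : Fin (m + 1), (L / n : ℝ) ≤ ((y i.succ : ℝ) - y i.castSucc + 1) / n := by
    intro i
    have : (y i.castSucc : ℝ) + L ≤ y i.succ := by exact_mod_cast hstep i
    gcongr
    linarith
  have hg0 : ∀ i : Fin (m + 1), 0 ≤ ((y i.succ : ℝ) - y i.castSucc + 1) / n := fun i =>
    (by positivity : (0 : ℝ) ≤ L / n).trans (hg i)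
  have hmono : StrictMono y := Fin.strictMono_iff_lt_succ.2 fun i => by
    have := hstep i
    omega
  rcases I.eq_empty_or_nonempty with rfl | hI
  · simp only [Finset.prod_empty, one_mul, Finset.notMem_empty, false_and, Finset.filter_false]
    rw [div_le_one hn']
    exact_mod_cast (Finset.card_le_univ _).trans (by simp)
  obtain ⟨i, hi, himin⟩ := I.exists_min_image id hI
  have hR0 : 0 ≤ (∏ i ∈ I, (((y i.succ : ℝ) - y i.castSucc + 1) / n)) *
        ∏ _i ∈ Finset.univ.filter (fun i : Fin m => i.castSucc ∈ I ∧ i.succ ∈ I), κ :=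
    mul_nonneg (Finset.prod_nonneg fun i _ => hg0 i) (Finset.prod_nonneg fun _ _ => hκ0.le)
  by_cases hfar : ∃ j ∈ I, (i : ℕ) + 1 < j
  · obtain ⟨j, hj, hij⟩ := hfar
    have : chainLevels n y I = ∅ := by
      refine Finset.eq_empty_of_forall_notMem fun b hb => ?_
      have hb := (Finset.mem_filter.1 hb).2
      have h1 := (hb i hi).2
      have h2 := (hb j hj).1
      have h3 : y i.succ < y j.castSucc := hmono (by simpa [Fin.lt_def] using hij)
      omega
    rw [this]
    simpa using hR0
  push Not at hfar
  by_cases hnext : ∃ j ∈ I, j ≠ i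
  · obtain ⟨j, hj, hji⟩ := hnext
    have hij : (j : ℕ) = i + 1 := by
      have h1 := hfar j hj
      have h2 : (i : ℕ) ≤ j := himin j hj
      have h3 : (j : ℕ) ≠ i := fun h => hji (Fin.ext h)
      omega
    have hIeq : I = {i, j} := by
      ext l
      simp only [Finset.mem_insert, Finset.mem_singleton]
      constructor
      · intro hl
        have h1 := hfar l hl
        have h2 : (i : ℕ) ≤ l := himin l hl
        rcases eq_or_ne (l : ℕ) i with h | h
        · exact Or.inl (Fin.ext h)
        · exact Or.inr (Fin.ext (by omega))
      · rintro (rfl | rfl) <;> assumption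
    have hyij : y i.succ = y j.castSucc := by
      congr 1
      exact Fin.ext (by simp [hij])
    have hcard : (chainLevels n y I).card ≤ 1 := by
      refine (Finset.card_le_card (t := Finset.univ.filter
        fun x : Fin n => y i.succ ≤ x ∧ (x : ℕ) ≤ y i.succ) ?_).trans
        ((card_fin_filter_Icc_le _ _ _).trans (by omega))
      intro b hb
      have hb := (Finset.mem_filter.1 hb).2
      have h1 := (hb i hi).2
      have h2 := (hb j hj).1
      simp only [Finset.mem_filter, Finset.mem_univ, true_and]
      omega
    have hprodκ : κ ≤
        ∏ _i ∈ Finset.univ.filter (fun i : Fin m => i.castSucc ∈ I ∧ i.succ ∈ I), κ := by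
      rw [Finset.prod_const]
      refine (pow_one κ).symm.le.trans (pow_le_pow_of_le_one hκ0.le hκ1 ?_)
      refine Finset.card_le_one.2 fun a ha b hb => ?_
      have key : ∀ c : Fin m, c.castSucc ∈ I → c.succ ∈ I → (c : ℕ) = i := by
        intro c hc hc'
        have h1 : (i : ℕ) ≤ c := himin _ hc
        have h2 := hfar _ hc'
        simp only [Fin.val_succ] at h2
        omega
      have ha := (Finset.mem_filter.1 ha).2
      have hb := (Finset.mem_filter.1 hb).2
      exact Fin.ext ((key a ha.1 ha.2).trans (key b hb.1 hb.2).symm)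
    have hprodg : (L / n : ℝ) * (L / n) ≤
        ∏ i ∈ I, (((y i.succ : ℝ) - y i.castSucc + 1) / n) := by
      rw [hIeq, Finset.prod_pair hji.symm]
      exact mul_le_mul (hg i) (hg j) (by positivity) (hg0 i)
    calc ((chainLevels n y I).card / n : ℝ) ≤ 1 / n := by
          gcongr
          exact_mod_cast hcard
      _ ≤ (L / n : ℝ) * (L / n) * κ := by
          rw [div_mul_div_comm, div_mul_eq_mul_div, div_le_div_iff₀ hn' (by positivity)]
          nlinarith
      _ ≤ _ := mul_le_mul hprodg hprodκ hκ0.le (Finset.prod_nonneg fun i _ => hg0 i)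
  · push Not at hnext
    have hIeq : I = {i} := Finset.eq_singleton_iff_unique_mem.2 ⟨hi, hnext⟩
    have hempty : Finset.univ.filter (fun i : Fin m => i.castSucc ∈ I ∧ i.succ ∈ I) = ∅ := by
      refine Finset.filter_eq_empty_iff.2 fun c _ hc => ?_
      have := (hnext _ hc.1).trans (hnext _ hc.2).symm
      simp [Fin.ext_iff] at this
    rw [hempty, Finset.prod_empty, mul_one, hIeq, Finset.prod_singleton]
    gcongr
    have h1 : (chainLevels n y {i}).card ≤ y i.succ + 1 - y i.castSucc := by
      refine le_trans (le_of_eq ?_) (card_fin_filter_Icc_le n _ _)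
      simp [chainLevels]
    have h2 := hstep i
    have h3 : (chainLevels n y {i}).card + y i.castSucc ≤ y i.succ + 1 := by omega
    have h4 : ((chainLevels n y {i}).card : ℝ) + y i.castSucc ≤ y i.succ + 1 := by
      exact_mod_cast h3
    linarith

/-- The probability that a chain of edges is ordered along the levels `y`. -/
theorem prod_card_chainLevels_le {V : Type*} [DecidableEq V] {m n L : ℕ} (hn : 0 < n) (hL : 0 < L)
    (h : Fin (m + 1) → Finset V) (hcard : ∀ i, (h i).card = n)
    (hmeet : ∀ i : Fin m, (h i.castSucc ∩ h i.succ).Nonempty)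
    (y : Fin (m + 2) → ℕ) (hy0 : y 0 = 0) (hylast : y (Fin.last _) = n - 1)
    (hstep : ∀ i : Fin (m + 1), y i.castSucc + L ≤ y i.succ) {κ : ℝ} (hκ1 : κ ≤ 1)
    (hκ : (n : ℝ) ≤ κ * L ^ 2) :
    ∏ v ∈ Finset.univ.biUnion h,
        ((chainLevels n y (Finset.univ.filter fun i => v ∈ h i)).card / n : ℝ) ≤
      ((1 + m / n) / ((m : ℝ) + 1)) ^ ((m + 1) * n) * κ ^ m := by
  have hn' : (0 : ℝ) < n := by exact_mod_cast hn
  have hκ0 : 0 < κ := by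
    by_contra h
    nlinarith [sq_nonneg (L : ℝ)]
  set g : Fin (m + 1) → ℝ := fun i => ((y i.succ : ℝ) - y i.castSucc + 1) / n with hgdef
  have hg0 : ∀ i, 0 ≤ g i := by
    intro i
    have h1 : (y i.castSucc : ℝ) ≤ y i.succ := by
      exact_mod_cast (Nat.le_add_right _ L).trans (hstep i)
    exact div_nonneg (by linarith) hn'.le
  -- The differences telescope to `n - 1`, and the `m + 1` closed intervals add one level each.
  have hsum : ∑ i, g i ≤ 1 + m / n := by
    have h1 := Fin.sum_succ_sub_castSucc fun i => (y i : ℝ)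
    rw [hgdef, ← Finset.sum_div, Finset.sum_add_distrib, h1, hy0, hylast]
    rw [Nat.cast_sub (by omega)]
    refine le_of_eq ?_
    field_simp
    simp
  calc _ ≤ ∏ v ∈ Finset.univ.biUnion h,
        ((∏ i ∈ Finset.univ.filter (fun i => v ∈ h i), g i) *
        ∏ _i ∈ Finset.univ.filter (fun i : Fin m => v ∈ h i.castSucc ∧ v ∈ h i.succ), κ) := by
        refine Finset.prod_le_prod (fun v _ => by positivity) fun v _ => ?_
        simpa only [Finset.mem_filter, Finset.mem_univ, true_and] using
          card_chainLevels_div_le hn hL y hstep hκ1 hκ (Finset.univ.filter fun i => v ∈ h i)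
    _ = (∏ i, ∏ _v ∈ h i, g i) * ∏ i : Fin m, ∏ _v ∈ h i.castSucc ∩ h i.succ, κ := by
        rw [Finset.prod_mul_distrib]
        congr 1
        · refine Finset.prod_comm' fun v i => ?_
          simp only [Finset.mem_biUnion, Finset.mem_filter, Finset.mem_univ, true_and]
          exact ⟨fun h => ⟨h.2, trivial⟩, fun h => ⟨⟨i, h.1⟩, h.1⟩⟩
        · refine Finset.prod_comm' fun v i => ?_
          simp only [Finset.mem_biUnion, Finset.mem_filter, Finset.mem_univ, true_and,
            Finset.mem_inter]
          exact ⟨fun h => ⟨h.2, trivial⟩, fun h => ⟨⟨_, h.1.1⟩, h.1⟩⟩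
    -- Consecutive edges may share several vertices; since `κ ≤ 1`, keeping one factor `κ` per link
    -- suffices.
    _ ≤ (∏ i, g i ^ n) * ∏ _i : Fin m, κ := by
        refine mul_le_mul (le_of_eq ?_) ?_ (by positivity)
          (Finset.prod_nonneg fun i _ => pow_nonneg (hg0 i) n)
        · simp [hcard]
        · refine Finset.prod_le_prod (fun _ _ => by positivity) fun i _ => ?_
          rw [Finset.prod_const]
          exact (pow_le_pow_of_le_one hκ0.le hκ1 (Finset.card_pos.2 (hmeet i))).trans
            (pow_one κ).le
    _ ≤ _ := by
        rw [Finset.prod_pow, Finset.prod_const, Finset.card_univ, Fintype.card_fin, pow_mul]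
        gcongr
        · exact Finset.prod_nonneg fun i _ => hg0 i
        · simpa using prod_le_pow_of_sum_le g hg0 hsum

/-- Gaps of at least `L` on both sides force `j * L ≤ y j ≤ n - 1 - (m + 1 - j) * L`, so each of the
`m` inner cuts has at most `n - (m + 1) * L` positions. -/
theorem card_level_sequences_le {m n L : ℕ} (hn : 0 < n) (hL : 0 < L)
    (Y : Finset (Fin (m + 2) → ℕ))
    (hY : ∀ y ∈ Y, y 0 = 0 ∧ y (Fin.last _) = n - 1 ∧
      ∀ i : Fin (m + 1), y i.castSucc + L ≤ y i.succ) :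
    Y.card ≤ (n - (m + 1) * L) ^ m := by
  let W : Fin (m + 2) → Finset ℕ := fun j =>
    if j = 0 then {0} else if j = Fin.last _ then {n - 1} else
      Finset.Icc (j * L) (n - 1 - (m + 1 - j) * L)
  have hsub : Y ⊆ Fintype.piFinset W := by
    intro y hy
    obtain ⟨h0, hlast, hstep⟩ := hY y hy
    have hlow : ∀ j : Fin (m + 2), j * L ≤ y j := by
      intro j
      induction j using Fin.induction with
      | zero => simp
      | succ i ih =>
        have := hstep i
        simp only [Fin.val_succ, Fin.val_castSucc, add_mul, one_mul] at ih ⊢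
        omega
    have hhigh : ∀ j : Fin (m + 2), y j + (m + 1 - j) * L ≤ n - 1 := by
      intro j
      induction j using Fin.reverseInduction with
      | last => simp [hlast]
      | cast i ih =>
        have h1 := hstep i
        have h2 : m + 1 - (i.castSucc : ℕ) = (m + 1 - (i.succ : ℕ)) + 1 := by
          simp only [Fin.val_succ, Fin.val_castSucc]
          omega
        rw [h2, add_mul, one_mul]
        omega
    refine Fintype.mem_piFinset.2 fun j => ?_
    simp only [W]
    split_ifs with hj hj'
    · simp [hj, h0]
    · simp [hj', hlast]
    · rw [Finset.mem_Icc]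
      have := hhigh j
      exact ⟨hlow j, by omega⟩
  refine (Finset.card_le_card hsub).trans ?_
  rw [Fintype.card_piFinset, Fin.prod_univ_succ, Fin.prod_univ_castSucc]
  have hmid : ∀ i : Fin m, (W i.castSucc.succ).card ≤ n - (m + 1) * L := by
    intro i
    have h1 : i.castSucc.succ ≠ 0 := Fin.succ_ne_zero _
    have h2 : i.castSucc.succ ≠ Fin.last (m + 1) := by
      rw [Fin.succ_castSucc]
      exact Fin.castSucc_ne_last _
    simp only [W, if_neg h1, if_neg h2, Nat.card_Icc, Fin.val_succ, Fin.val_castSucc]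
    have h3 : (m + 1 - ((i : ℕ) + 1)) * L + ((i : ℕ) + 1) * L = (m + 1) * L := by
      rw [← add_mul]
      congr 1
      omega
    -- Needed when the upper end of the interval truncates to 0: a positive lower end then makes the
    -- interval empty.
    have h4 : 0 < ((i : ℕ) + 1) * L := by positivity
    omega
  have hfirst : (W 0).card = 1 := by simp [W]
  have hlast : (W (Fin.last m).succ).card = 1 := by
    simp [W, Fin.succ_last]
  rw [hfirst, hlast, one_mul, mul_one]
  calc ∏ i : Fin m, (W i.castSucc.succ).card ≤ ∏ _i : Fin m, (n - (m + 1) * L) :=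
        Finset.prod_le_prod' fun i _ => hmid i
    _ = _ := by simp

/-! ### The random ordered colouring -/

/-- The random ordered colouring argument, with the numerical conditions made explicit: `L` is the
length below which the spread of the weights of an edge is forbidden. -/
theorem exists_coloring_of_numeric_bounds {V E : Type*} (S : E → Finset V) (nbr : E → Finset E)
    (hnbr : ∀ e f, f ∈ nbr e ↔ ¬ Disjoint (S e) (S f)) {m n L d : ℕ} (hn : 0 < n) (hL : 0 < L)
    (hcard : ∀ e, (S e).card = n) (hd : ∀ e, (nbr e).card ≤ d) {κ : ℝ} (hκ1 : κ ≤ 1)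
    (hκ : (n : ℝ) ≤ κ * L ^ 2)
    (hshort : ((m + 1) * d * n : ℝ) * (L / n : ℝ) ^ n ≤ 1 / 8)
    (hchain : ((m + 1) ^ 2 * d ^ (m + 1) * ((n - (m + 1) * L : ℕ) : ℝ) ^ m : ℝ) *
      (((1 + m / n) / ((m : ℝ) + 1)) ^ ((m + 1) * n) * κ ^ m) ≤ 1 / 8) :
    ∃ c : V → Fin (m + 1), ∀ e, ∃ u ∈ S e, ∃ v ∈ S e, c u ≠ c v := by
  classical
  have hSne : ∀ e, (S e).Nonempty := fun e => Finset.card_pos.1 (by rw [hcard]; exact hn)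
  have hn' : (0 : ℝ) < n := by exact_mod_cast hn
  have hκ0 : 0 < κ := by
    by_contra h
    nlinarith [sq_nonneg (L : ℝ)]
  have hsymm : ∀ e f, f ∈ nbr e → e ∈ nbr f := fun e f h =>
    (hnbr f e).2 fun h' => (hnbr e f).1 h h'.symm
  have : Nonempty (Fin n) := ⟨⟨0, hn⟩⟩
  let K := {p : (Fin (m + 1) → E) × (Fin (m + 2) → ℕ) //
    (∀ i : Fin m, p.1 i.succ ∈ nbr (p.1 i.castSucc)) ∧ p.2 0 = 0 ∧ p.2 (Fin.last _) = n - 1 ∧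
      ∀ i : Fin (m + 1), p.2 i.castSucc + L ≤ p.2 i.succ}
  -- Two kinds of bad event: an edge lies in the window of `L` levels starting at a given level, or
  -- a chain of edges fits a given cut sequence.
  let T : (E × Fin n) ⊕ K → Finset V :=
    Sum.elim (fun q => S q.1) fun p => Finset.univ.biUnion fun i => S (p.1.1 i)
  let J : (E × Fin n) ⊕ K → V → Finset (Fin n) :=
    Sum.elim (fun q _ => Finset.univ.filter fun b => (q.2 : ℕ) ≤ b ∧ (b : ℕ) ≤ q.2 + L - 1)
      fun p v => chainLevels n p.1.2 (Finset.univ.filter fun i => v ∈ S (p.1.1 i))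
  have hT : ∀ i, (T i).Nonempty := by
    rintro (q | p)
    · exact hSne q.1
    · obtain ⟨v, hv⟩ := hSne (p.1.1 0)
      exact ⟨v, Finset.mem_biUnion.2 ⟨0, Finset.mem_univ _, hv⟩⟩
  -- The support of any event is covered by at most `m + 1` edges, each meeting at most `d` edges,
  -- itself included.
  have hX : ∀ i, ∃ X : Finset E, X.card ≤ (m + 1) * d ∧
      ∀ f, ¬ Disjoint (T i) (S f) → f ∈ X := by
    rintro (q | p)
    · exact ⟨nbr q.1, (hd _).trans (Nat.le_mul_of_pos_left _ (Nat.succ_pos m)),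
        fun f hf => (hnbr _ _).2 hf⟩
    · refine ⟨Finset.univ.biUnion fun i => nbr (p.1.1 i), ?_, fun f hf => ?_⟩
      · simpa using Finset.card_biUnion_le_card_mul Finset.univ (fun i => nbr (p.1.1 i)) d
          fun i _ => hd _
      · simp only [T, Sum.elim_inr, Finset.disjoint_biUnion_left, not_forall] at hf
        obtain ⟨i, hi, hf⟩ := hf
        exact Finset.mem_biUnion.2 ⟨i, hi, (hnbr _ _).2 hf⟩
  obtain ⟨w, hw⟩ := exists_avoiding_boxes T J hT fun i s hs => by
    obtain ⟨X, hXcard, hX⟩ := hX i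
    have hXcard' : (X.card : ℝ) ≤ (m + 1) * d := by exact_mod_cast hXcard
    rw [Finset.sum_sum_eq_sum_toLeft_add_sum_toRight]
    have hleft : ∑ q ∈ s.toLeft, ∏ u ∈ T (Sum.inl q),
        ((J (Sum.inl q) u).card / Fintype.card (Fin n) : ℝ) ≤ 1 / 8 := by
      refine le_trans ?_ hshort
      have h1 : ∀ q ∈ s.toLeft, ∏ u ∈ T (Sum.inl q),
          ((J (Sum.inl q) u).card / Fintype.card (Fin n) : ℝ) ≤ (L / n : ℝ) ^ n := by
        intro q _
        rw [Fintype.card_fin]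
        calc _ ≤ ∏ _u ∈ T (Sum.inl q), (L / n : ℝ) := by
              refine Finset.prod_le_prod (fun _ _ => by positivity) fun u _ => ?_
              gcongr
              refine (card_fin_filter_Icc_le n (q.2 : ℕ) (q.2 + L - 1)).trans ?_
              omega
          _ = _ := by rw [Finset.prod_const]; exact congrArg _ (hcard q.1)
      refine (Finset.sum_le_card_nsmul _ _ _ h1).trans ?_
      rw [nsmul_eq_mul]
      gcongr
      have h2 : s.toLeft ⊆ X ×ˢ Finset.univ := by
        intro q hq
        refine Finset.mem_product.2 ⟨hX q.1 (hs (Sum.inl q) (Finset.mem_toLeft.1 hq)),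
          Finset.mem_univ _⟩
      have h3 := Finset.card_le_card h2
      rw [Finset.card_product, Finset.card_univ, Fintype.card_fin] at h3
      calc (s.toLeft.card : ℝ) ≤ X.card * n := by exact_mod_cast h3
        _ ≤ _ := by gcongr
    have hright : ∑ p ∈ s.toRight, ∏ u ∈ T (Sum.inr p),
        ((J (Sum.inr p) u).card / Fintype.card (Fin n) : ℝ) ≤ 1 / 8 := by
      refine le_trans ?_ hchain
      have h1 : ∀ p ∈ s.toRight, ∏ u ∈ T (Sum.inr p),
          ((J (Sum.inr p) u).card / Fintype.card (Fin n) : ℝ) ≤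
            (((1 + m / n) / ((m : ℝ) + 1)) ^ ((m + 1) * n) * κ ^ m) := by
        intro p _
        rw [Fintype.card_fin]
        refine prod_card_chainLevels_le hn hL (fun i => S (p.1.1 i)) (fun i => hcard _)
          (fun i => ?_) p.1.2 p.2.2.1 p.2.2.2.1 p.2.2.2.2 hκ1 hκ
        exact Finset.not_disjoint_iff_nonempty_inter.1 ((hnbr _ _).1 (p.2.1 i))
      refine (Finset.sum_le_card_nsmul _ _ _ h1).trans ?_
      rw [nsmul_eq_mul]
      gcongr
      let P : Finset _ := s.toRight.image Subtype.val
      let H := P.image Prod.fst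
      let Y := P.image Prod.snd
      have hP : s.toRight.card = P.card :=
        (Finset.card_image_of_injective _ Subtype.val_injective).symm
      have hPHY : P ⊆ H ×ˢ Y := Finset.subset_product
      have hY : Y.card ≤ (n - (m + 1) * L) ^ m := by
        refine card_level_sequences_le hn hL Y fun y hy => ?_
        obtain ⟨_, hp, rfl⟩ := Finset.mem_image.1 hy
        obtain ⟨p, _, rfl⟩ := Finset.mem_image.1 hp
        exact p.2.2
      -- A neighbouring chain has some edge `h j` in `X`. The `m + 1` choices of `j`, with the
      -- factor `m + 1` in the bound on `X`, give the `(m + 1) ^ 2` of `hchain`.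
      have hHsub : H ⊆ Finset.univ.biUnion fun j : Fin (m + 1) => H.filter fun h => h j ∈ X := by
        intro h hh
        obtain ⟨_, hp, rfl⟩ := Finset.mem_image.1 hh
        obtain ⟨p, hps, rfl⟩ := Finset.mem_image.1 hp
        have hdis := hs (Sum.inr p) (Finset.mem_toRight.1 hps)
        simp only [T, Sum.elim_inr, Finset.disjoint_biUnion_right, not_forall] at hdis
        obtain ⟨j, hj, hdis⟩ := hdis
        exact Finset.mem_biUnion.2 ⟨j, hj, Finset.mem_filter.2 ⟨hh, hX _ hdis⟩⟩
      have hH : H.card ≤ (m + 1) * (d ^ m * X.card) := by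
        refine (Finset.card_le_card hHsub).trans ?_
        simpa using Finset.card_biUnion_le_card_mul Finset.univ
          (fun j : Fin (m + 1) => H.filter fun h => h j ∈ X) (d ^ m * X.card) fun j _ => by
            refine card_walks_le nbr hsymm d hd X m j _ fun h hh => ?_
            obtain ⟨hh, hj⟩ := Finset.mem_filter.1 hh
            obtain ⟨_, hp, rfl⟩ := Finset.mem_image.1 hh
            obtain ⟨p, _, rfl⟩ := Finset.mem_image.1 hp
            exact ⟨hj, p.2.1⟩
      have h4 := (Finset.card_le_card hPHY).trans_eq (Finset.card_product _ _)
      calc (s.toRight.card : ℝ) ≤ H.card * Y.card := by rw [hP]; exact_mod_cast h4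
        _ ≤ ((m + 1) * (d ^ m * X.card)) * ((n - (m + 1) * L : ℕ) : ℝ) ^ m := by
          gcongr
          · exact_mod_cast hH
          · exact_mod_cast hY
        _ ≤ ((m + 1) * (d ^ m * ((m + 1) * d))) * ((n - (m + 1) * L : ℕ) : ℝ) ^ m := by gcongr
        _ = _ := by ring
    linarith
  refine exists_coloring_of_forall_not_isOrderedChain S w hSne m fun h p hc => ?_
  have hspread : ∀ i : Fin (m + 1), (w (p i.castSucc) : ℕ) + L ≤ w (p i.succ) := by
    intro i
    obtain ⟨u, hu, hu'⟩ := hw (Sum.inl (h i, w (p i.castSucc)))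
    have h1 : (w (p i.castSucc) : ℕ) ≤ w u := ((hc i).2.2 u hu).1
    have h2 : (w u : ℕ) ≤ w (p i.succ) := ((hc i).2.2 u hu).2
    have h3 : ¬ ((w (p i.castSucc) : ℕ) ≤ w u ∧ (w u : ℕ) ≤ w (p i.castSucc) + L - 1) := by
      simpa [J] using hu'
    omega
  -- Moving the outer cuts to `0` and `n - 1` only enlarges the first and last intervals, and leaves
  -- just `m` free cuts to count.
  let y : Fin (m + 2) → ℕ := fun j =>
    if j = 0 then 0 else if j = Fin.last _ then n - 1 else w (p j)
  have hlow : ∀ i : Fin (m + 1), y i.castSucc ≤ w (p i.castSucc) := by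
    intro i
    simp only [y, if_neg (Fin.castSucc_ne_last i)]
    split_ifs
    · exact Nat.zero_le _
    · exact le_rfl
  have hhigh : ∀ i : Fin (m + 1), (w (p i.succ) : ℕ) ≤ y i.succ := by
    intro i
    simp only [y, if_neg (Fin.succ_ne_zero i)]
    split_ifs
    · have := (w (p i.succ)).isLt
      omega
    · exact le_rfl
  have hvalid : (∀ i : Fin m, h i.succ ∈ nbr (h i.castSucc)) ∧ y 0 = 0 ∧
      y (Fin.last _) = n - 1 ∧ ∀ i : Fin (m + 1), y i.castSucc + L ≤ y i.succ := by
    refine ⟨fun i => ?_, by simp [y], by simp [y], fun i => ?_⟩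
    · rw [hnbr, Finset.not_disjoint_iff]
      exact ⟨p i.castSucc.succ, (hc i.castSucc).2.1, (hc i.succ).1⟩
    · have h1 := hlow i
      have h2 := hhigh i
      have h3 := hspread i
      omega
  obtain ⟨u, -, hu'⟩ := hw (Sum.inr ⟨(h, y), hvalid⟩)
  refine hu' (Finset.mem_filter.2 ⟨Finset.mem_univ _, fun i hi => ?_⟩)
  have hi : u ∈ S (h i) := (Finset.mem_filter.1 hi).2
  have h1 := (hc i).2.2 u hi
  exact ⟨(hlow i).trans h1.1, le_trans h1.2 (hhigh i)⟩

theorem smallDegreesColorable_of_numeric_bounds {m n L d : ℕ} (hn : 0 < n) (hL : 0 < L) {κ : ℝ}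
    (hκ1 : κ ≤ 1) (hκ : (n : ℝ) ≤ κ * L ^ 2)
    (hshort : ((m + 1) * d * n : ℝ) * (L / n : ℝ) ^ n ≤ 1 / 8)
    (hchain : ((m + 1) ^ 2 * d ^ (m + 1) * ((n - (m + 1) * L : ℕ) : ℝ) ^ m : ℝ) *
      (((1 + m / n) / ((m : ℝ) + 1)) ^ ((m + 1) * n) * κ ^ m) ≤ 1 / 8) :
    SmallDegreesColorable.{u} n (m + 1) d := by
  classical
  intro V H hunif hdeg
  have hfin : ∀ e : E(H), (e : Set V).Finite := fun e =>
    Set.finite_of_encard_eq_coe (hunif e e.2)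
  let S : E(H) → Finset V := fun e => (hfin e).toFinset
  have hS : ∀ e, ((S e : Finset V) : Set V) = e := fun e => (hfin e).coe_toFinset
  have hcard : ∀ e, (S e).card = n := fun e => by
    have := hunif e e.2
    rw [← hS e, Set.encard_coe_eq_coe_finsetCard] at this
    exact_mod_cast this
  have hdisj : ∀ e f : E(H), ¬ Disjoint (S e) (S f) ↔ ((e : Set V) ∩ f).Nonempty := fun e f => by
    rw [← Finset.disjoint_coe, hS, hS, Set.not_disjoint_iff_nonempty_inter]
  have hle : ∀ e : E(H), {f : E(H) | ¬ Disjoint (S e) (S f)}.encard ≤ d := by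
    intro e
    rw [← Subtype.val_injective.encard_image]
    have hsub : Subtype.val '' {f : E(H) | ¬ Disjoint (S e) (S f)} ⊆
        insert (e : Set V) {f | f ∈ E(H) ∧ f ≠ e ∧ ((e : Set V) ∩ f).Nonempty} := by
      rintro _ ⟨f, hf, rfl⟩
      by_cases hfe : (f : Set V) = e
      · exact Or.inl hfe
      · exact Or.inr ⟨f.2, hfe, (hdisj e f).1 hf⟩
    refine (Set.encard_le_encard hsub).trans ((Set.encard_insert_le _ _).trans ?_)
    -- The strict degree bound leaves room to count `e` among its own neighbours.
    exact Order.add_one_le_of_lt (hdeg e e.2)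
  have hfinN : ∀ e : E(H), {f : E(H) | ¬ Disjoint (S e) (S f)}.Finite := fun e =>
    Set.finite_of_encard_le_coe (hle e)
  obtain ⟨c, hc⟩ := exists_coloring_of_numeric_bounds S (fun e => (hfinN e).toFinset)
    (fun e f => by simp) hn hL hcard
    (fun e => by
      have := hle e
      rw [(hfinN e).encard_eq_coe_toFinset_card] at this
      exact_mod_cast this) hκ1 hκ hshort hchain
  refine ⟨c, fun e he => ?_⟩
  obtain ⟨u, hu, v, hv, huv⟩ := hc ⟨e, he⟩
  exact ⟨c u, ⟨u, by simpa [S] using hu, rfl⟩, c v, ⟨v, by simpa [S] using hv, rfl⟩, huv⟩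

/-! ### Choice of parameters and asymptotics -/

/-- Here `F` plays the role of `(n / ln n) ^ (m / (m + 1))`; only its `(m + 1)`-th power and the
bounds `0 ≤ F ≤ n` matter, so no real exponents enter. -/
theorem smallDegreesColorable_of_le {m n d : ℕ} {c F : ℝ} (hc0 : 0 < c) (hc1 : c ≤ 1)
    (hc : ((m : ℝ) + 1) ^ 2 * (20 * ((m : ℝ) + 1) ^ 2) ^ m * Real.exp (m * (m + 1)) * c ≤ 1 / 8)
    (hn : 8 * ((m : ℝ) + 1) ^ 2 ≤ n) (hlog : (m : ℝ) + 2 ≤ 2 * Real.log n)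
    (hlogn : 10 * Real.log n ≤ n) (hF0 : 0 ≤ F) (hFn : F ≤ n)
    (hF : F ^ (m + 1) = (n / Real.log n) ^ m) (hd : (d : ℝ) ≤ c * (F * ((m : ℝ) + 1) ^ n)) :
    SmallDegreesColorable.{u} n (m + 1) d := by
  set ℓ := Real.log n
  set r : ℝ := (m : ℝ) + 1 with hr
  have hr1 : 1 ≤ r := by rw [hr]; linarith [(Nat.cast_nonneg m : (0 : ℝ) ≤ m)]
  have hr0 : 0 < r := by linarith
  have hℓ : 0 < ℓ := by linarith
  have hn0 : (0 : ℝ) < n := by nlinarith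
  have hnat : 0 < n := by exact_mod_cast hn0
  -- The slack `3 ln n` makes `(r * L / n) ^ n ≤ n ^ (-3)`. This absorbs one `n` from the choice of
  -- window and one from `d ≤ n * r ^ n`, leaving `r / n`.
  set q := ⌈3 * ℓ⌉₊ with hq
  have hq1 : 3 * ℓ ≤ q := Nat.le_ceil _
  have hq2 : (q : ℝ) < 3 * ℓ + 1 := Nat.ceil_lt_add_one (by positivity)
  have hqn : q ≤ n := by
    have : (q : ℝ) ≤ n := by linarith
    exact_mod_cast this
  set L := (n - q) / (m + 1) with hL
  have hL1 : (m + 1) * L ≤ n - q := Nat.mul_div_le _ _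
  have hL2 : n - q < (m + 1) * L + (m + 1) := by
    have := Nat.lt_mul_div_succ (n - q) (Nat.succ_pos m)
    rw [← hL, Nat.succ_eq_add_one, mul_add, mul_one] at this
    exact this
  have hL1' : r * L ≤ n - 3 * ℓ := by
    have : (((m + 1) * L + q : ℕ) : ℝ) ≤ n := by exact_mod_cast (by omega)
    push_cast at this
    linarith
  have hQ : ((n - (m + 1) * L : ℕ) : ℝ) ≤ 5 * ℓ := by
    have : ((n - (m + 1) * L : ℕ) : ℝ) ≤ ((q + m + 1 : ℕ) : ℝ) := by exact_mod_cast (by omega)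
    push_cast at this
    linarith
  have hL2' : (n : ℝ) ≤ 2 * (r * L) := by
    have : (n : ℝ) ≤ (((m + 1) * L + (n - (m + 1) * L) : ℕ) : ℝ) := by exact_mod_cast (by omega)
    push_cast at this
    linarith
  have hLpos : 0 < L := by
    rcases Nat.eq_zero_or_pos L with h | h
    · rw [h] at hL2'
      norm_num at hL2'
      omega
    · exact h
  -- The value `κ = 4 * r ^ 2 / n` comes from `L ≥ n / (2 * r)`.
  have hκ : (n : ℝ) ≤ 4 * r ^ 2 / n * L ^ 2 := by
    rw [div_mul_eq_mul_div, le_div_iff₀ hn0]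
    nlinarith
  have hκ1 : 4 * r ^ 2 / n ≤ 1 := by
    rw [div_le_one hn0]
    nlinarith
  refine smallDegreesColorable_of_numeric_bounds hnat hLpos hκ1 hκ ?_ ?_
  · have h1 : (r * L / n : ℝ) ^ n ≤ 1 / (n : ℝ) ^ 3 := by
      have h2 : r * L / n ≤ Real.exp (-(3 * ℓ / n)) := by
        refine le_trans ?_ (Real.one_sub_le_exp_neg _)
        rw [div_le_iff₀ hn0, sub_mul, div_mul_cancel₀ _ hn0.ne', one_mul]
        exact hL1'
      calc (r * L / n : ℝ) ^ n ≤ Real.exp (-(3 * ℓ / n)) ^ n :=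
            pow_le_pow_left₀ (by positivity) h2 _
        _ = (Real.exp ℓ ^ 3)⁻¹ := by
            rw [← Real.exp_nat_mul, ← Real.exp_nat_mul, ← Real.exp_neg]
            congr 1
            field_simp
            norm_num
        _ = 1 / (n : ℝ) ^ 3 := by rw [Real.exp_log hn0, one_div]
    calc (r * d * n : ℝ) * (L / n : ℝ) ^ n ≤ (r * (1 * (n * r ^ n)) * n) * (L / n : ℝ) ^ n := by
          gcongr
          refine hd.trans ?_
          gcongr
      _ = r * n ^ 2 * (r * L / n : ℝ) ^ n := by
          rw [mul_div_assoc r, mul_pow r]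
          ring
      _ ≤ r * n ^ 2 * (1 / (n : ℝ) ^ 3) := by gcongr
      _ = r / n := by field_simp
      _ ≤ 1 / 8 := by
          rw [div_le_div_iff₀ hn0 (by norm_num)]
          nlinarith
  · have h1 : (1 + (m : ℝ) / n) ^ ((m + 1) * n) ≤ Real.exp (m * (m + 1)) := by
      calc (1 + (m : ℝ) / n) ^ ((m + 1) * n) ≤ Real.exp (m / n) ^ ((m + 1) * n) := by
            gcongr
            rw [add_comm]
            exact Real.add_one_le_exp _
        _ = _ := by
            rw [← Real.exp_nat_mul]
            congr 1
            push_cast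
            field_simp
    have h2 : (d : ℝ) ^ (m + 1) ≤ c * ((n / ℓ) ^ m * r ^ ((m + 1) * n)) := by
      calc (d : ℝ) ^ (m + 1) ≤ (c * (F * r ^ n)) ^ (m + 1) := by gcongr
        _ = c ^ (m + 1) * ((n / ℓ) ^ m * r ^ ((m + 1) * n)) := by
            rw [mul_pow, mul_pow, hF, ← pow_mul, mul_comm n]
        _ ≤ _ := by
            gcongr
            exact pow_le_of_le_one hc0.le hc1 (Nat.succ_ne_zero m)
    calc (r ^ 2 * d ^ (m + 1) * ((n - (m + 1) * L : ℕ) : ℝ) ^ m : ℝ) *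
          (((1 + m / n) / r) ^ ((m + 1) * n) * (4 * r ^ 2 / n) ^ m)
        ≤ (r ^ 2 * (c * ((n / ℓ) ^ m * r ^ ((m + 1) * n))) * (5 * ℓ) ^ m) *
          (Real.exp (m * (m + 1)) / r ^ ((m + 1) * n) * (4 * r ^ 2 / n) ^ m) := by
          rw [div_pow (1 + (m : ℝ) / n)]
          gcongr
      -- Per link, the degree bound `n / ℓ`, the `5 * ℓ` cut positions and the pinning factor `4 * r
      -- ^ 2 / n` multiply to the constant `20 * r ^ 2`.
      _ = r ^ 2 * ((n / ℓ) * (5 * ℓ) * (4 * r ^ 2 / n)) ^ m * Real.exp (m * (m + 1)) * c := by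
          rw [mul_pow (n / ℓ * (5 * ℓ)), mul_pow (n / ℓ : ℝ) (5 * ℓ)]
          have hne : r ^ ((m + 1) * n) ≠ 0 := by positivity
          generalize r ^ ((m + 1) * n) = a at hne ⊢
          generalize ((n : ℝ) / ℓ) ^ m = b
          generalize (4 * r ^ 2 / (n : ℝ)) ^ m = b'
          generalize (5 * ℓ) ^ m = b''
          field_simp
      _ = r ^ 2 * (20 * r ^ 2) ^ m * Real.exp (m * (m + 1)) * c := by
          congr 4
          field_simp
          norm_num
      _ ≤ 1 / 8 := hc

theorem le_localThreshold {n r d : ℕ} (h : SmallDegreesColorable.{u} n r d) :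
    d ≤ localThreshold.{u} n r := by
  obtain ⟨B, hB⟩ := exists_forall_smallDegreesColorable_le.{u} n r
  exact le_csSup ⟨B, fun d hd => hB d hd⟩ h

theorem theorem3 (r : ℕ) (hr : 2 ≤ r) :
    (fun n : ℕ => ((n : ℝ) / Real.log n) ^ (((r : ℝ) - 1) / r) * (r : ℝ) ^ n)
      =O[atTop] (fun n : ℕ => (localThreshold.{u} n r : ℝ)) := by
  obtain ⟨m, rfl⟩ : ∃ m, r = m + 1 := ⟨r - 1, by omega⟩
  have hm : (1 : ℝ) ≤ m := by exact_mod_cast (by omega : 1 ≤ m)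
  set A : ℝ := ((m : ℝ) + 1) ^ 2 * (20 * ((m : ℝ) + 1) ^ 2) ^ m * Real.exp (m * (m + 1))
  have hA : 0 < A := by positivity
  set c : ℝ := min 1 (1 / (8 * A))
  have hc0 : 0 < c := lt_min one_pos (by positivity)
  have hcA : A * c ≤ 1 / 8 :=
    (mul_le_mul_of_nonneg_left (min_le_right _ _) hA.le).trans_eq (by field_simp)
  have hcast := tendsto_natCast_atTop_atTop (R := ℝ)
  have hpow : Tendsto (fun n : ℕ => ((m : ℝ) + 1) ^ n) atTop atTop :=
    tendsto_pow_atTop_atTop_of_one_lt (by linarith)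
  -- The factor 2 pays for rounding down: once `r ^ n ≥ 1 / c`, the number being rounded is at least
  -- 1, hence less than twice its floor.
  refine IsBigO.of_bound (2 / c) ?_
  filter_upwards [hcast.eventually_ge_atTop (8 * ((m : ℝ) + 1) ^ 2),
    (Real.tendsto_log_atTop.comp hcast).eventually_ge_atTop ((m : ℝ) + 2),
    hcast.eventually (Real.isLittleO_log_id_atTop.bound (by norm_num : (0 : ℝ) < 1 / 10)),
    hpow.eventually_ge_atTop (1 / c)] with n hn hlog hlogn hrn
  simp only [Function.comp_apply] at hlog
  have hℓ1 : 1 ≤ Real.log n := by linarith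
  have hℓ0 : 0 < Real.log n := by linarith
  have hn0 : (0 : ℝ) < n := by nlinarith
  have hlogn' : 10 * Real.log n ≤ n := by
    simp only [id, Real.norm_eq_abs, abs_of_pos hℓ0, abs_of_pos hn0] at hlogn
    linarith
  have hbase : 1 ≤ (n : ℝ) / Real.log n := by
    rw [one_le_div hℓ0]
    linarith
  push_cast
  rw [add_sub_cancel_right]
  set F : ℝ := ((n : ℝ) / Real.log n) ^ ((m : ℝ) / (m + 1)) with hFdef
  have hF1 : 1 ≤ F := Real.one_le_rpow hbase (by positivity)
  have hFn : F ≤ n := by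
    calc F ≤ ((n : ℝ) / Real.log n) ^ (1 : ℝ) :=
          Real.rpow_le_rpow_of_exponent_le hbase (by rw [div_le_one (by positivity)]; linarith)
      _ ≤ n := by
          rw [Real.rpow_one]
          exact div_le_self hn0.le hℓ1
  have hFpow : F ^ (m + 1) = (n / Real.log n) ^ m := by
    rw [hFdef, ← Real.rpow_natCast, ← Real.rpow_mul (by positivity), ← Real.rpow_natCast]
    congr 1
    push_cast
    field_simp
  have hΦ : 1 ≤ c * (F * ((m : ℝ) + 1) ^ n) := by
    calc (1 : ℝ) = c * (1 * (1 / c)) := by field_simp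
      _ ≤ _ := by gcongr
  have hcol := le_localThreshold (smallDegreesColorable_of_le.{u}
    (d := ⌊c * (F * ((m : ℝ) + 1) ^ n)⌋₊) hc0 (min_le_left _ _) hcA hn (by linarith)
    hlogn' (by linarith) hFn hFpow (Nat.floor_le (by linarith)))
  have hcol' : (⌊c * (F * ((m : ℝ) + 1) ^ n)⌋₊ : ℝ) ≤ localThreshold.{u} n (m + 1) := by
    exact_mod_cast hcol
  have hfloor := Nat.lt_floor_add_one (c * (F * ((m : ℝ) + 1) ^ n))
  have hone : (1 : ℝ) ≤ ⌊c * (F * ((m : ℝ) + 1) ^ n)⌋₊ := by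
    exact_mod_cast Nat.le_floor (by simpa using hΦ)
  rw [Real.norm_of_nonneg (by positivity), Real.norm_of_nonneg (by positivity),
    div_mul_eq_mul_div, le_div_iff₀ hc0]
  linarith
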